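/- Let $S_j(x)=\frac{x}{2}+\frac{j}{4}$ for $j\in\{0,1,2\}$, and let $\mu$ be the uniform $(3,2)$-measure, i.e. the self-similar probability measure $\mu=\sum_{j=0}^{2}\frac13\,\mu\circ S_j^{-1}$. For a word $\sigma=(\sigma_1,\dots,\sigma_n)\in\{0,1,2\}^n$ put $S_\sigma=S_{\sigma_1}\circ\dots\circ S_{\sigma_n}$. For $n\ge 0$ let $g_n=\{S_\sigma(0):|\sigma|=n\}$, for $z\in g_n$ let $w_z=3^{-n}\,\#\{\sigma\in\{0,1,2\}^n: S_\sigma(0)=z\}$, and let $$h(n)=-\sum_{z\in g_n}w_z\log_2 w_z .$$ The Garsia entropy of $\mu$ is $\mathfrak H_{3,2}=\lim_{n\to\infty}\frac{h(n)}{n\log_2 2}$. For coprime integers $k>i\ge 1$ let $e(k,i)$ be the number of steps in which the simple Euclidean algorithm (replace the larger number by its difference with the smaller one) reduces the pair $\{k,i\}$ to $\{1,1\}$. Define, as a formal power series, $$L(x)=\sum_{n\ge 1}\ell(n)x^n=(1-3x)^2\sum_{n\ge 1}x^n\sum_{\substack{k>i\ge 1,\ \gcd(i,k)=1\\ e(k,i)=n}}k\log_2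 k ,$$ and put $$T_{3,2}(x)=\log_2 3-\frac{2}{3(1-x/3)^2}\,L(x/3).$$ Then the series $\sum_n\ell(n)x^n$ converges for $|x|<1$, the function $T=T_{3,2}$ is analytic on $\{x\in\mathbb C:|x|<3\}$ and $$\sum_{n\ge 0}h(n)x^n=\frac{x}{(x-1)^2}\,T_{3,2}(x)\qquad(|x|<1).$$ Moreover the limit defining $\mathfrak H_{3,2}$ exists and $$\mathfrak H_{3,2}=T_{3,2}(1),$$ and, more precisely, $h(n)=T(1)\,n-T'(1)+o(1)$ as $n\to\infty$. -/

import Mathlib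

noncomputable section

namespace CantorLike

/-- The contraction `S_j(x) = x / d + (j / d) * ((d - 1) / (m - 1))`. -/
def contraction (m d : ℕ) (j : Fin m) (x : ℝ) : ℝ :=
  x / d + (j : ℝ) / d * (((d : ℝ) - 1) / ((m : ℝ) - 1))

/-- `S_σ = S_{σ₁} ∘ ⋯ ∘ S_{σₙ}` for a word `σ` of length `n` over `{0, …, m - 1}`. -/
def wordMap (m d : ℕ) {n : ℕ} (σ : Fin n → Fin m) (x : ℝ) : ℝ :=
  (List.ofFn σ).foldr (contraction m d) x

/-- The set `g_n` of nodes at level `n` of the `(m,d)`-graph: the distinct points `S_σ(0)`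
with `|σ| = n`. -/
def nodes (m d n : ℕ) : Finset ℝ :=
  Finset.univ.image fun σ : Fin n → Fin m => wordMap m d σ 0

/-- The weight `w_z = ∑ p_σ` of a node `z` at level `n`, the sum being over all words `σ` of
length `n` with `S_σ(0) = z`, and `p_σ = p_{σ₁} ⋯ p_{σₙ}`. -/
def weight (m d : ℕ) (p : Fin m → ℝ) (n : ℕ) (z : ℝ) : ℝ :=
  ∑ σ : Fin n → Fin m with wordMap m d σ 0 = z, ∏ i, p (σ i)

/-- The entropy `h_μ(n)` of level `n`, where `μ` is the `(m,d)`-measure with probabilities `p`;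
one summand for each node. -/
def levelEntropy (m d : ℕ) (p : Fin m → ℝ) (n : ℕ) : ℝ :=
  -∑ z ∈ nodes m d n, weight m d p n z * Real.logb 2 (weight m d p n z)

/-- The Garsia entropy of the `(m,d)`-measure with probabilities `p` exists and equals `H`. -/
def HasGarsiaEntropy (m d : ℕ) (p : Fin m → ℝ) (H : ℝ) : Prop :=
  Filter.Tendsto (fun n : ℕ => levelEntropy m d p n / ((n : ℝ) * Real.logb 2 d))
    Filter.atTop (nhds H)

/-- The probabilities of the uniform `(m,d)`-measure. -/
def uniformProb (m : ℕ) : Fin m → ℝ := fun _ => 1 / (m : ℝ)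

/-- `e(k,i)`: the number of steps in which the simple Euclidean algorithm (replace the larger
number by its difference with the smaller one) reduces the pair `{k,i}` of positive integers to
the pair `{g,g}`, `g` their gcd. (The value is `0` if one of the numbers is `0`.) -/
def euclidSteps (k i : ℕ) : ℕ :=
  if k = 0 ∨ i = 0 ∨ k = i then 0
  else if i < k then euclidSteps (k - i) i + 1
  else euclidSteps k (i - k) + 1
termination_by k + i
decreasing_by all_goals omega

/-- The pairs `(k,i)` with `k > i ≥ 1`, `gcd(i,k) = 1` and `e(k,i) = n`. The bound `k ≤ 2 ^ n` is
automatic, see `mem_euclidPairs`. -/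
def euclidPairs (n : ℕ) : Finset (ℕ × ℕ) :=
  (Finset.range (2 ^ n + 1) ×ˢ Finset.range (2 ^ n + 1)).filter fun q =>
    1 ≤ q.2 ∧ q.2 < q.1 ∧ Nat.gcd q.2 q.1 = 1 ∧ euclidSteps q.1 q.2 = n

theorem le_two_pow_euclidSteps : ∀ N k i : ℕ, k + i ≤ N → 1 ≤ k → 1 ≤ i → Nat.gcd i k = 1 →
    k ≤ 2 ^ euclidSteps k i ∧ i ≤ 2 ^ euclidSteps k i := by
  intro N
  induction N with
  | zero => intro k i h hk; omega
  | succ N ih =>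
    intro k i h hk hi hg
    rw [euclidSteps]
    by_cases h1 : k = i
    · subst h1
      simp at hg
      subst hg
      simp
    · rw [if_neg (by omega)]
      by_cases h2 : i < k
      · rw [if_pos h2]
        obtain ⟨h3, h4⟩ := ih (k - i) i (by omega) (by omega) hi
          (by rw [Nat.gcd_sub_self_right h2.le]; exact hg)
        rw [pow_succ]
        omega
      · rw [if_neg h2]
        obtain ⟨h3, h4⟩ := ih k (i - k) (by omega) hk (by omega)
          (by rw [Nat.gcd_sub_self_left (by omega)]; exact hg)
        rw [pow_succ]
        omega

theorem mem_euclidPairs (n : ℕ) (q : ℕ × ℕ) : q ∈ euclidPairs n ↔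
    1 ≤ q.2 ∧ q.2 < q.1 ∧ Nat.gcd q.2 q.1 = 1 ∧ euclidSteps q.1 q.2 = n := by
  simp only [euclidPairs, Finset.mem_filter, Finset.mem_product, Finset.mem_range]
  refine ⟨fun h => h.2, fun h => ⟨?_, h⟩⟩
  obtain ⟨h1, h2, h3, h4⟩ := h
  have := le_two_pow_euclidSteps _ q.1 q.2 le_rfl (by omega) h1 h3
  rw [h4] at this
  omega

/-- The sum of `k log₂ k` over all pairs `k > i ≥ 1` with `gcd(i,k) = 1` and `e(k,i) = n`. -/
def euclidSum (n : ℕ) : ℝ :=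
  ∑ q ∈ euclidPairs n, (q.1 : ℝ) * Real.logb 2 q.1

/-- The coefficient `ℓ(n)` of the power series `(1 - 3x)² ∑ₙ euclidSum(n) xⁿ`. (The coefficient
`euclidSum 0` is an empty sum.) -/
def ell (n : ℕ) : ℝ :=
  PowerSeries.coeff n
    ((1 - PowerSeries.C (3 : ℝ) * PowerSeries.X) ^ 2 * PowerSeries.mk euclidSum)

/-- `L(x) = ∑ₙ ℓ(n) xⁿ`. -/
def L (x : ℂ) : ℂ := ∑' n : ℕ, (ell n : ℂ) * x ^ n

/-- `T_{3,2}(x) = log₂ 3 - 2 / (3 (1 - x/3)²) * L(x/3)`. -/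
def T32 (x : ℂ) : ℂ :=
  (Real.logb 2 3 : ℂ) - 2 / (3 * (1 - x / 3) ^ 2) * L (x / 3)

end CantorLike

end

namespace CantorLike

open Finset

/-! ### The operator of the Calkin-Wilf tree -/

/-! Since `S_σ(0)` is an integer determined by the digits of `σ`, divided by `2 ^ (n + 1)`, the
entropy `h(n)` is `n log₂ 3` minus `3⁻ⁿ ∑ r log₂ r` over the multiplicities `r` of these integers.
The multiplicities obey Stern's diatomic recurrence, so consecutive ones form the levels of
Calkin-Wilf trees, governed by one operator A (`childSum`). The tree rooted at (1,1) runs the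
Euclidean algorithm backwards, so its level `n` holds the coprime pairs with `n` steps. Two
first-order recurrences then give `2x / (1 - x)² * E(x)` for the generating function of `∑ r log₂
r`, where `E` is that of `euclidSum`. With `E = L / (1 - 3x)²` and `x` rescaled to `x/3`, this is
the formula for `T`.

The crux is that `∑ ℓ(n)` converges absolutely. Put `G(a,b) = (a+b) log₂ (a+b)` and let `s` be
`splitEntropy`. Then `ℓ(n+3) = Aⁿ(A-3)²G(1,1)`, and `(A-3)G = (1-A)s`, so `ℓ(n+3) = d(n) - d(n+1)`
with `d(n) = Aⁿ(A-3)s(1,1)`. Both `s` and `(1-A)s` are subadditive and homogeneous, A preserves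
these properties, and for such `F` one has `(A-3)F(1,1) ≥ 0`. Hence `d(n)` and `ℓ(n+3)` are
nonnegative, and the telescoping sums are at most `d(0)`.

So the coefficients `t` of `T` are summable at every radius below 3, and `h(n) = ∑ (n-k) t(k)` over
`k ≤ n` is asymptotically `T(1) n - T'(1)`. -/

/-- The operator summing a function of pairs over the two children `(a, a + b)` and `(a + b, b)`
of a pair `(a, b)` in the Calkin-Wilf tree. -/
def childSum : (ℕ → ℕ → ℝ) →ₗ[ℝ] (ℕ → ℕ → ℝ) where
  toFun F := fun a b => F a (a + b) + F (a + b) b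
  map_add' F G := by
    ext a b
    simp only [Pi.add_apply]
    ring
  map_smul' c F := by
    ext a b
    simp only [Pi.smul_apply, smul_eq_mul, RingHom.id_apply]
    ring

theorem childSum_apply (F : ℕ → ℕ → ℝ) (a b : ℕ) :
    childSum F a b = F a (a + b) + F (a + b) b := rfl

theorem childSum_pow_succ (n : ℕ) (F : ℕ → ℕ → ℝ) (a b : ℕ) :
    (childSum ^ (n + 1)) F a b = (childSum ^ n) F a (a + b) + (childSum ^ n) F (a + b) b := by
  rw [pow_succ', Module.End.mul_apply, childSum_apply]

theorem childSum_pow_succ' (n : ℕ) (F : ℕ → ℕ → ℝ) :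
    (childSum ^ (n + 1)) F = (childSum ^ n) (childSum F) := by
  rw [pow_succ, Module.End.mul_apply]

/-- The function `x log₂ x` on the natural numbers. -/
noncomputable def mulLogb (k : ℕ) : ℝ := (k : ℝ) * Real.logb 2 k

@[simp] theorem mulLogb_zero : mulLogb 0 = 0 := by simp [mulLogb]

@[simp] theorem mulLogb_one : mulLogb 1 = 0 := by simp [mulLogb]

/-! ### Words, their values and their multiplicities -/

/-- The integer `∑ σ_i 2 ^ (n - i)` with digits the letters of the word `σ`. -/
def wordVal : (n : ℕ) → (Fin n → Fin 3) → ℕ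
  | 0, _ => 0
  | n + 1, σ => 2 * wordVal n (Fin.init σ) + (σ (Fin.last n) : ℕ)

theorem wordMap_eq (n : ℕ) (σ : Fin n → Fin 3) (x : ℝ) :
    wordMap 3 2 σ x = wordVal n σ / 2 ^ (n + 1) + x / 2 ^ n := by
  induction n generalizing x with
  | zero => simp [wordMap, wordVal]
  | succ n ih =>
    -- The innermost map belongs to the last letter, which is why `x` is generalized in the
    -- induction.
    have h : wordMap 3 2 σ x
        = wordMap 3 2 (Fin.init σ) (contraction 3 2 (σ (Fin.last n)) x) := by
      simp only [wordMap]
      rw [List.ofFn_succ', List.concat_eq_append, List.foldr_append]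
      rfl
    rw [h, ih]
    simp only [contraction, wordVal]
    push_cast
    field_simp
    ring

theorem wordMap_zero_eq_iff {n : ℕ} (σ τ : Fin n → Fin 3) :
    wordMap 3 2 σ 0 = wordMap 3 2 τ 0 ↔ wordVal n σ = wordVal n τ := by
  rw [wordMap_eq, wordMap_eq, zero_div, add_zero, add_zero,
    div_left_inj' (by positivity), Nat.cast_inj]

theorem wordVal_add_one_lt (n : ℕ) (σ : Fin n → Fin 3) : wordVal n σ + 1 < 2 ^ (n + 1) := by
  induction n with
  | zero => simp [wordVal]
  | succ n ih =>
    have h := ih (Fin.init σ)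
    have h' := (σ (Fin.last n)).isLt
    simp only [wordVal]
    rw [pow_succ]
    omega

/-- The number of words `σ` of length `n` with value `M - 1`. -/
def wordCount (n M : ℕ) : ℕ := #{σ : Fin n → Fin 3 | wordVal n σ + 1 = M}

theorem wordCount_succ (n M : ℕ) : wordCount (n + 1) M =
    ∑ j : Fin 3, #{σ : Fin n → Fin 3 | 2 * wordVal n σ + j + 1 = M} := by
  simp only [wordCount, card_filter]
  rw [← (Fin.snocEquiv fun _ => Fin 3).sum_comp, Fintype.sum_prod_type]
  simp [wordVal, Fin.snocEquiv]

/-- The parity of the value fixes the parity of the last letter. Because of the shift by one in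
`wordCount`, an even index forces the letter 1, and an odd index allows 0 and 2. -/
theorem wordCount_succ_two_mul (n M : ℕ) : wordCount (n + 1) (2 * M) = wordCount n M := by
  rw [wordCount_succ, Fin.sum_univ_three, wordCount]
  have h0 : #{σ : Fin n → Fin 3 | 2 * wordVal n σ + (0 : Fin 3) + 1 = 2 * M} = 0 := by
    rw [card_eq_zero, filter_eq_empty_iff]
    intro σ _
    simp only [Fin.val_zero]
    omega
  have h2 : #{σ : Fin n → Fin 3 | 2 * wordVal n σ + (2 : Fin 3) + 1 = 2 * M} = 0 := by
    rw [card_eq_zero, filter_eq_empty_iff]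
    intro σ _
    simp only [Fin.val_two]
    omega
  rw [h0, h2, zero_add, add_zero]
  congr 1
  ext σ
  simp only [mem_filter, mem_univ, true_and, Fin.val_one]
  omega

theorem wordCount_succ_two_mul_add_one (n M : ℕ) :
    wordCount (n + 1) (2 * M + 1) = wordCount n M + wordCount n (M + 1) := by
  rw [wordCount_succ, Fin.sum_univ_three, wordCount, wordCount]
  have h1 : #{σ : Fin n → Fin 3 | 2 * wordVal n σ + (1 : Fin 3) + 1 = 2 * M + 1} = 0 := by
    rw [card_eq_zero, filter_eq_empty_iff]
    intro σ _
    simp only [Fin.val_one]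
    omega
  rw [h1, add_zero, add_comm]
  congr 2 <;> ext σ <;>
    simp only [mem_filter, mem_univ, true_and, Fin.val_zero, Fin.val_two] <;> omega

/-- A consecutive pair `(a, b)` of multiplicities at positions `M`, `M + 1` refines to `a, a + b, b`
at positions `2M`, `2M + 1`, `2M + 2`, that is, to its two children. Level 0 reads `0, 1, 0`, hence
the two roots. -/
theorem sum_wordCount (n : ℕ) (F : ℕ → ℕ → ℝ) :
    ∑ M ∈ range (2 ^ (n + 1)), F (wordCount n M) (wordCount n (M + 1)) =
      (childSum ^ n) F 0 1 + (childSum ^ n) F 1 0 := by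
  induction n generalizing F with
  | zero => simp [sum_range_succ, wordCount, wordVal]
  | succ n ih =>
    have split (f : ℕ → ℝ) (m : ℕ) :
        ∑ i ∈ range (m * 2), f i = ∑ i ∈ range m, (f (2 * i) + f (2 * i + 1)) := by
      induction m with
      | zero => simp
      | succ m hm =>
        rw [Nat.succ_mul, sum_range_succ, sum_range_succ, hm, sum_range_succ, mul_comm m 2]
        ring
    rw [childSum_pow_succ', ← ih, pow_succ, split]
    refine sum_congr rfl fun M _ => ?_
    rw [childSum_apply, show 2 * M + 1 + 1 = 2 * (M + 1) by ring, wordCount_succ_two_mul,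
      wordCount_succ_two_mul, wordCount_succ_two_mul_add_one]

/-- The sum of `r log₂ r` over the multiplicities `r` of all nodes of level `n`. -/
noncomputable def countEntropy (n : ℕ) : ℝ := ∑ M ∈ range (2 ^ (n + 1)), mulLogb (wordCount n M)

theorem sum_logb_wordCount (n : ℕ) :
    ∑ σ : Fin n → Fin 3, Real.logb 2 (wordCount n (wordVal n σ + 1)) = countEntropy n := by
  rw [← sum_fiberwise_of_maps_to (t := range (2 ^ (n + 1))) (g := fun σ => wordVal n σ + 1)
    fun σ _ => mem_range.2 (wordVal_add_one_lt n σ), countEntropy]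
  refine sum_congr rfl fun M _ => ?_
  rw [sum_congr rfl (g := fun _ => Real.logb 2 (wordCount n M)), sum_const, nsmul_eq_mul]
  · rfl
  · intro σ hσ
    rw [(mem_filter.1 hσ).2]

theorem weight_wordMap {n : ℕ} (σ : Fin n → Fin 3) :
    weight 3 2 (uniformProb 3) n (wordMap 3 2 σ 0) = wordCount n (wordVal n σ + 1) / 3 ^ n := by
  simp only [weight, uniformProb, prod_const, card_univ, Fintype.card_fin, sum_const,
    nsmul_eq_mul, wordCount, wordMap_zero_eq_iff, add_left_inj]
  simp [div_eq_mul_inv]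

theorem wordCount_pos {n : ℕ} (σ : Fin n → Fin 3) : 0 < wordCount n (wordVal n σ + 1) :=
  card_pos.2 ⟨σ, by simp⟩

/-- Summing over words instead of nodes makes the entropy the mean of `-log₂ (r / 3ⁿ)`, with `r` the
multiplicity of the word's node. -/
theorem levelEntropy_eq (n : ℕ) : levelEntropy 3 2 (uniformProb 3) n =
    n * Real.logb 2 3 - countEntropy n / 3 ^ n := by
  have h1 : ∑ z ∈ nodes 3 2 n, weight 3 2 (uniformProb 3) n z *
        Real.logb 2 (weight 3 2 (uniformProb 3) n z) =
      ∑ σ : Fin n → Fin 3, (1 / 3 ^ n : ℝ) *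
        Real.logb 2 (weight 3 2 (uniformProb 3) n (wordMap 3 2 σ 0)) := by
    rw [← sum_fiberwise_of_maps_to (t := nodes 3 2 n) (g := fun σ => wordMap 3 2 σ 0)
      fun σ _ => mem_image_of_mem _ (mem_univ σ)]
    refine sum_congr rfl fun z _ => ?_
    conv_lhs => rw [weight, sum_mul]
    refine sum_congr rfl fun σ hσ => ?_
    rw [(mem_filter.1 hσ).2]
    congr 1
    simp [uniformProb]
  have h2 (σ : Fin n → Fin 3) :
      Real.logb 2 (weight 3 2 (uniformProb 3) n (wordMap 3 2 σ 0)) =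
        Real.logb 2 (wordCount n (wordVal n σ + 1)) - n * Real.logb 2 3 := by
    have := wordCount_pos σ
    rw [weight_wordMap, Real.logb_div (by positivity) (by positivity), Real.logb_pow]
  rw [levelEntropy, h1]
  simp only [h2]
  rw [← mul_sum, sum_sub_distrib, sum_logb_wordCount]
  simp
  field_simp
  ring

theorem countEntropy_eq (n : ℕ) : countEntropy n =
    (childSum ^ n) (fun a _ => mulLogb a) 0 1 + (childSum ^ n) (fun a _ => mulLogb a) 1 0 :=
  sum_wordCount n fun a _ => mulLogb a

/-! ### The pairs with a given number of Euclidean steps -/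

/-- The pairs of level `n` of the Calkin-Wilf tree. -/
def treePairs : ℕ → Finset (ℕ × ℕ)
  | 0 => {(1, 1)}
  | n + 1 => (treePairs n).image (fun q => (q.1, q.1 + q.2)) ∪
      (treePairs n).image fun q => (q.1 + q.2, q.2)

theorem euclidSteps_add_left {a b : ℕ} (ha : 1 ≤ a) (hb : 1 ≤ b) :
    euclidSteps (a + b) b = euclidSteps a b + 1 := by
  rw [euclidSteps, if_neg (by omega), if_pos (by omega), Nat.add_sub_cancel]

theorem euclidSteps_add_right {a b : ℕ} (ha : 1 ≤ a) (hb : 1 ≤ b) :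
    euclidSteps a (a + b) = euclidSteps a b + 1 := by
  rw [euclidSteps, if_neg (by omega), if_neg (by omega), Nat.add_sub_cancel_left]

theorem mem_treePairs (n : ℕ) (q : ℕ × ℕ) : q ∈ treePairs n ↔
    1 ≤ q.1 ∧ 1 ≤ q.2 ∧ Nat.gcd q.2 q.1 = 1 ∧ euclidSteps q.1 q.2 = n := by
  induction n generalizing q with
  | zero =>
    obtain ⟨k, i⟩ := q
    simp only [treePairs, mem_singleton, Prod.mk.injEq]
    constructor
    · rintro ⟨rfl, rfl⟩
      simp [euclidSteps]
    · rintro ⟨hk, hi, hg, he⟩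
      rw [euclidSteps] at he
      by_cases h : k = i
      · subst h
        simp at hg
        omega
      · rw [if_neg (by omega)] at he
        split_ifs at he
  | succ n ih =>
    obtain ⟨k, i⟩ := q
    simp only [treePairs, mem_union, mem_image, ih, Prod.exists, Prod.mk.injEq]
    constructor
    · rintro (⟨a, b, ⟨ha, hb, hg, he⟩, rfl, rfl⟩ | ⟨a, b, ⟨ha, hb, hg, he⟩, rfl, rfl⟩)
      · exact ⟨ha, by omega, by simpa using hg, by rw [euclidSteps_add_right ha hb, he]⟩
      · exact ⟨by omega, hb, by simpa using hg, by rw [euclidSteps_add_left ha hb, he]⟩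
    · rintro ⟨hk, hi, hg, he⟩
      rcases lt_trichotomy k i with h | rfl | h
      · obtain ⟨c, rfl⟩ := Nat.exists_eq_add_of_lt h
        rw [add_assoc, euclidSteps_add_right hk (by omega)] at he
        exact Or.inl ⟨k, c + 1, ⟨hk, by omega, by simpa [add_assoc] using hg, by omega⟩, rfl,
          by ring⟩
      · rw [euclidSteps] at he
        simp at he
      · obtain ⟨c, rfl⟩ := Nat.exists_eq_add_of_lt h
        rw [show i + c + 1 = (c + 1) + i by ring] at he hg
        rw [euclidSteps_add_left (by omega) hi] at he
        exact Or.inr ⟨c + 1, i, ⟨by omega, hi, by simpa using hg, by omega⟩, by ring, rfl⟩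

theorem sum_treePairs (n : ℕ) (F : ℕ → ℕ → ℝ) :
    ∑ q ∈ treePairs n, F q.1 q.2 = (childSum ^ n) F 1 1 := by
  induction n generalizing F with
  | zero => simp [treePairs]
  | succ n ih =>
    rw [childSum_pow_succ', ← ih, treePairs, sum_union, sum_image, sum_image,
      ← sum_add_distrib]
    · rfl
    · rintro ⟨a, b⟩ _ ⟨c, d⟩ _ h
      simp only [Prod.mk.injEq] at h ⊢
      omega
    · rintro ⟨a, b⟩ _ ⟨c, d⟩ _ h
      simp only [Prod.mk.injEq] at h ⊢
      omega
    -- One family of children has first entry below the second, the other above it.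
    · rw [disjoint_left]
      intro q hq hq'
      simp only [mem_image, mem_treePairs] at hq hq'
      obtain ⟨r, hr, rfl⟩ := hq
      obtain ⟨s, hs, h⟩ := hq'
      simp only [Prod.mk.injEq] at h
      omega

theorem euclidPairs_succ (n : ℕ) :
    euclidPairs (n + 1) = (treePairs n).image fun q => (q.1 + q.2, q.2) := by
  ext ⟨k, i⟩
  simp only [mem_euclidPairs, mem_image, mem_treePairs, Prod.exists, Prod.mk.injEq]
  constructor
  · rintro ⟨hi, h, hg, he⟩
    obtain ⟨c, rfl⟩ := Nat.exists_eq_add_of_lt h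
    rw [show i + c + 1 = (c + 1) + i by ring] at he hg
    rw [euclidSteps_add_left (by omega) hi] at he
    exact ⟨c + 1, i, ⟨by omega, hi, by simpa using hg, by omega⟩, by ring, rfl⟩
  · rintro ⟨a, b, ⟨ha, hb, hg, he⟩, rfl, rfl⟩
    exact ⟨hb, by omega, by simpa using hg, by rw [euclidSteps_add_left ha hb, he]⟩

theorem euclidSum_zero : euclidSum 0 = 0 := by
  rw [euclidSum, sum_eq_zero]
  rintro ⟨k, i⟩ h
  obtain ⟨h1, h2, -, h4⟩ := (mem_euclidPairs 0 _).1 h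
  simp only at h1 h2 h4
  rw [euclidSteps, if_neg (by omega), if_pos h2] at h4
  omega

theorem euclidSum_succ (n : ℕ) :
    euclidSum (n + 1) = (childSum ^ n) (fun a b => mulLogb (a + b)) 1 1 := by
  rw [← sum_treePairs, euclidSum, euclidPairs_succ, sum_image]
  · rfl
  · rintro ⟨a, b⟩ _ ⟨c, d⟩ _ h
    simp only [Prod.mk.injEq] at h ⊢
    omega

/-! ### Recurrences for the sums -/

/-- The sum of `a log₂ a` over the pairs `(a, b)` of level `n` of the Calkin-Wilf tree. -/
noncomputable def treeEntropy (n : ℕ) : ℝ := (childSum ^ n) (fun a _ => mulLogb a) 1 1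

theorem countEntropy_zero : countEntropy 0 = 0 := by simp [countEntropy_eq]

/-- One child of the root (0,1) is (0,1) itself and the other is (1,1); likewise for (1,0). -/
theorem countEntropy_succ (n : ℕ) :
    countEntropy (n + 1) = countEntropy n + 2 * treeEntropy n := by
  simp only [countEntropy_eq, treeEntropy, childSum_pow_succ, add_zero, zero_add]
  ring

theorem treeEntropy_zero : treeEntropy 0 = 0 := by simp [treeEntropy]

theorem treeEntropy_succ (n : ℕ) :
    treeEntropy (n + 1) = treeEntropy n + euclidSum (n + 1) := by
  have h : childSum (fun a _ => mulLogb a) =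
      (fun a _ => mulLogb a) + fun a b => mulLogb (a + b) := rfl
  rw [treeEntropy, childSum_pow_succ', h, map_add, euclidSum_succ]
  rfl

/-! ### Subadditivity and the coefficients `ℓ(n)` -/

/-- The log-sum inequality. With `q = (a + c) / (s + t)`, the bound `log y ≥ 1 - 1/y` at `y = u / (v
q)` gives `key`; the two lower bounds add up to `a + c - (s + t) q = 0`. -/
theorem log_sum_le {a c s t : ℝ} (ha : 0 < a) (hc : 0 < c) (hs : 0 < s) (ht : 0 < t) :
    (a + c) * (Real.log (a + c) - Real.log (s + t)) ≤
      a * (Real.log a - Real.log s) + c * (Real.log c - Real.log t) := by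
  have key {u v : ℝ} (hu : 0 < u) (hv : 0 < v) :
      u - v * ((a + c) / (s + t)) ≤
        u * ((Real.log u - Real.log v) - (Real.log (a + c) - Real.log (s + t))) := by
    have h := Real.one_sub_inv_le_log_of_pos (x := (u / v) / ((a + c) / (s + t))) (by positivity)
    rw [Real.log_div (by positivity) (by positivity), Real.log_div hu.ne' hv.ne',
      Real.log_div (by positivity) (by positivity)] at h
    refine le_trans (le_of_eq ?_) (mul_le_mul_of_nonneg_left h hu.le)
    field_simp
  have h1 := key ha hs
  have h2 := key hc ht
  have h3 : (s + t) * ((a + c) / (s + t)) = a + c := by field_simp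
  linarith

/-- The function `a log₂ a + b log₂ b - (a + b) log₂ (a + b)`. -/
noncomputable def splitEntropy (a b : ℕ) : ℝ := mulLogb a + mulLogb b - mulLogb (a + b)

theorem mulLogb_mul {c k : ℕ} (hc : 0 < c) (hk : 0 < k) :
    mulLogb (c * k) = c * mulLogb k + c * k * Real.logb 2 c := by
  have hc' : (c : ℝ) ≠ 0 := by positivity
  have hk' : (k : ℝ) ≠ 0 := by positivity
  simp only [mulLogb, Nat.cast_mul, Real.logb_mul hc' hk']
  ring

/-- Subadditivity on pairs of positive integers. -/
def IsSubadditive (F : ℕ → ℕ → ℝ) : Prop :=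
  ∀ a b c d : ℕ, 0 < a → 0 < b → 0 < c → 0 < d → F (a + c) (b + d) ≤ F a b + F c d

/-- Homogeneity of degree one on pairs of positive integers. -/
def IsHomogeneous (F : ℕ → ℕ → ℝ) : Prop :=
  ∀ k a b : ℕ, 0 < k → 0 < a → 0 < b → F (k * a) (k * b) = k * F a b

theorem IsSubadditive.childSum_pow {F : ℕ → ℕ → ℝ} (hF : IsSubadditive F) (n : ℕ) :
    IsSubadditive ((childSum ^ n) F) := by
  induction n with
  | zero => simpa using hF
  | succ n ih =>
    intro a b c d ha hb hc hd
    simp only [childSum_pow_succ]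
    have h1 := ih a (a + b) c (c + d) ha (by omega) hc (by omega)
    have h2 := ih (a + b) b (c + d) d (by omega) hb (by omega) hd
    rw [show a + b + (c + d) = a + c + (b + d) by ring] at h1 h2
    linarith

theorem IsHomogeneous.childSum_pow {F : ℕ → ℕ → ℝ} (hF : IsHomogeneous F) (n : ℕ) :
    IsHomogeneous ((childSum ^ n) F) := by
  induction n with
  | zero => simpa using hF
  | succ n ih =>
    intro k a b hk ha hb
    simp only [childSum_pow_succ]
    rw [← mul_add, ih k _ _ hk ha (by omega), ih k _ _ hk (by omega) hb]
    ring

theorem isSubadditive_splitEntropy : IsSubadditive splitEntropy := by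
  intro a b c d ha hb hc hd
  have ha' : (0 : ℝ) < a := by positivity
  have hb' : (0 : ℝ) < b := by positivity
  have hc' : (0 : ℝ) < c := by positivity
  have hd' : (0 : ℝ) < d := by positivity
  have h1 := log_sum_le ha' hc' (add_pos ha' hb') (add_pos hc' hd')
  have h2 := log_sum_le hb' hd' (add_pos ha' hb') (add_pos hc' hd')
  simp only [splitEntropy, mulLogb, Real.logb]
  push_cast
  have hl : 0 < Real.log 2 := Real.log_pos one_lt_two
  have e : (a + c + (b + d) : ℝ) = a + b + (c + d) := by ring
  rw [e]
  field_simp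
  linarith

theorem isHomogeneous_splitEntropy : IsHomogeneous splitEntropy := by
  intro k a b hk ha hb
  simp only [splitEntropy]
  rw [← mul_add, mulLogb_mul hk ha, mulLogb_mul hk hb, mulLogb_mul hk (by omega)]
  push_cast
  ring

/-- The single-entry terms cancel, leaving `(1-A)s = (A-3)G`: one factor `A - 3` is traded for the
telescoping factor `1 - A`. -/
theorem splitEntropy_sub_childSum :
    splitEntropy - childSum splitEntropy =
      childSum (fun a b => mulLogb (a + b)) - (3 : ℝ) • fun a b => mulLogb (a + b) := by
  ext a b
  simp only [Pi.sub_apply, Pi.smul_apply, childSum_apply, splitEntropy, smul_eq_mul]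
  ring

theorem isSubadditive_splitEntropy_sub_childSum :
    IsSubadditive (splitEntropy - childSum splitEntropy) := by
  -- `(1-A)s` is `s` composed with an additive map, plus an additive function, so it inherits
  -- subadditivity.
  have key (a b : ℕ) (h : 0 < a + b) : (splitEntropy - childSum splitEntropy) a b =
      splitEntropy (2 * a + b) (a + 2 * b) + 3 * (a + b) * Real.logb 2 3 := by
    rw [splitEntropy_sub_childSum]
    simp only [Pi.sub_apply, Pi.smul_apply, childSum_apply, splitEntropy, smul_eq_mul]
    rw [show 2 * a + b + (a + 2 * b) = 3 * (a + b) by ring, mulLogb_mul (by norm_num) h,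
      show a + (a + b) = 2 * a + b by ring, show a + b + b = a + 2 * b by ring]
    push_cast
    ring
  intro a b c d ha hb hc hd
  rw [key _ _ (by omega), key _ _ (by omega), key _ _ (by omega)]
  have h := isSubadditive_splitEntropy (2 * a + b) (a + 2 * b) (2 * c + d) (c + 2 * d)
    (by omega) (by omega) (by omega) (by omega)
  rw [show 2 * (a + c) + (b + d) = 2 * a + b + (2 * c + d) by ring,
    show a + c + 2 * (b + d) = a + 2 * b + (c + 2 * d) by ring]
  push_cast
  linarith

theorem three_mul_le_childSum {F : ℕ → ℕ → ℝ} (hs : IsSubadditive F) (hh : IsHomogeneous F) :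
    3 * F 1 1 ≤ childSum F 1 1 := by
  -- The children (1,2) and (2,1) of (1,1) add up to (3,3), and homogeneity evaluates `F` there.
  have h1 := hs 1 2 2 1 one_pos two_pos two_pos one_pos
  have h2 := hh 3 1 1 three_pos one_pos one_pos
  norm_num at h1 h2
  rw [childSum_apply]
  norm_num
  linarith

/-- The defect `F(1,2) + F(2,1) - 3 F(1,1)` of the `n`-th iterate of `splitEntropy`. -/
noncomputable def splitDefect (n : ℕ) : ℝ :=
  (childSum ^ (n + 1)) splitEntropy 1 1 - 3 * (childSum ^ n) splitEntropy 1 1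

theorem splitDefect_nonneg (n : ℕ) : 0 ≤ splitDefect n := by
  have h := three_mul_le_childSum (isSubadditive_splitEntropy.childSum_pow n)
    (isHomogeneous_splitEntropy.childSum_pow n)
  rw [splitDefect, pow_succ', Module.End.mul_apply]
  linarith

theorem one_sub_C_mul_X_sq_mul (c : ℝ) (φ : PowerSeries ℝ) :
    (1 - PowerSeries.C c * PowerSeries.X) ^ 2 * φ =
      φ - PowerSeries.C (2 * c) * (PowerSeries.X * φ) +
        PowerSeries.C (c ^ 2) * (PowerSeries.X * (PowerSeries.X * φ)) := by
  simp only [map_mul, map_pow, map_ofNat]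
  ring

theorem coeff_one_sub_C_mul_X_sq_mul (c : ℝ) (φ : PowerSeries ℝ) (n : ℕ) :
    PowerSeries.coeff (n + 2) ((1 - PowerSeries.C c * PowerSeries.X) ^ 2 * φ) =
      PowerSeries.coeff (n + 2) φ - 2 * c * PowerSeries.coeff (n + 1) φ +
        c ^ 2 * PowerSeries.coeff n φ := by
  rw [one_sub_C_mul_X_sq_mul, map_add, map_sub, PowerSeries.coeff_C_mul, PowerSeries.coeff_C_mul,
    PowerSeries.coeff_succ_X_mul, PowerSeries.coeff_succ_X_mul, PowerSeries.coeff_succ_X_mul]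

/-- The shift by 3 is needed because only `euclidSum (n + 1)` is an iterate of A; `euclidSum 0` is
not. -/
theorem ell_add_three (n : ℕ) : ell (n + 3) = splitDefect n - splitDefect (n + 1) := by
  set G : ℕ → ℕ → ℝ := fun a b => mulLogb (a + b) with hG
  have e (m : ℕ) : (childSum ^ m) splitEntropy 1 1 - (childSum ^ (m + 1)) splitEntropy 1 1 =
      euclidSum (m + 2) - 3 * euclidSum (m + 1) := by
    have h := congrArg (fun F => (childSum ^ m) F 1 1) splitEntropy_sub_childSum
    simp only [map_sub, map_smul, ← childSum_pow_succ', Pi.sub_apply, Pi.smul_apply,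
      smul_eq_mul] at h
    rw [h, euclidSum_succ, euclidSum_succ]
  rw [ell, show n + 3 = n + 1 + 2 from rfl, coeff_one_sub_C_mul_X_sq_mul]
  simp only [PowerSeries.coeff_mk, splitDefect]
  have e0 := e n
  have e1 := e (n + 1)
  linear_combination -e1 + 3 * e0

theorem ell_add_three_nonneg (n : ℕ) : 0 ≤ ell (n + 3) := by
  have h := three_mul_le_childSum (F := (childSum ^ n) (splitEntropy - childSum splitEntropy))
    (isSubadditive_splitEntropy_sub_childSum.childSum_pow n) ?_
  · rw [← Module.End.mul_apply, ← pow_succ', map_sub, map_sub, ← childSum_pow_succ',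
      ← childSum_pow_succ', Pi.sub_apply, Pi.sub_apply, Pi.sub_apply, Pi.sub_apply] at h
    rw [ell_add_three, splitDefect, splitDefect]
    linarith
  · intro k a b hk ha hb
    rw [map_sub, ← childSum_pow_succ']
    simp only [Pi.sub_apply]
    rw [isHomogeneous_splitEntropy.childSum_pow n k a b hk ha hb,
      isHomogeneous_splitEntropy.childSum_pow (n + 1) k a b hk ha hb]
    ring

theorem summable_abs_ell : Summable fun n => |ell n| := by
  refine (summable_nat_add_iff 3).1 ?_
  simp only [abs_of_nonneg (ell_add_three_nonneg _)]
  refine summable_of_sum_range_le (c := splitDefect 0) ell_add_three_nonneg fun n => ?_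
  simp only [ell_add_three]
  rw [sum_range_sub']
  linarith [splitDefect_nonneg n]

/-! ### The coefficients of `T` -/

/-- The coefficients of `L(x) / (1 - x)²`. -/
noncomputable def ellConv (n : ℕ) : ℝ := ∑ p ∈ antidiagonal n, ((p.1 : ℝ) + 1) * ell p.2

/-- The coefficients of `T`. -/
noncomputable def coeffT (n : ℕ) : ℝ :=
  (if n = 0 then Real.logb 2 3 else 0) - 2 / 3 * (ellConv n / 3 ^ n)

open PowerSeries in
theorem one_sub_C_mul_X_sq_mul_mk (c : ℝ) :
    (1 - C c * X) ^ 2 * PowerSeries.mk (fun n => (n : ℝ) * c ^ n) = C c * X := by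
  ext n
  rcases n with _ | _ | n
  · simp
  · rw [one_sub_C_mul_X_sq_mul, map_add, map_sub, coeff_C_mul, coeff_C_mul, coeff_C_mul,
      coeff_succ_X_mul, coeff_succ_X_mul]
    simp
  · rw [coeff_one_sub_C_mul_X_sq_mul]
    simp only [coeff_mk, coeff_C_mul, coeff_X]
    rw [if_neg (by omega)]
    push_cast
    ring

open PowerSeries in
theorem one_sub_X_sq_mul_mk : (1 - X) ^ 2 * PowerSeries.mk (fun n => (n : ℝ) + 1) = 1 := by
  have h := one_sub_C_mul_X_sq_mul_mk 1
  have h' : PowerSeries.mk (fun n => (n : ℝ) * 1 ^ n) = X * PowerSeries.mk (fun n => (n : ℝ) + 1) := by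
    ext n
    rcases n with _ | n <;> simp [coeff_succ_X_mul]
  rw [h', map_one, one_mul, mul_left_comm] at h
  exact mul_left_cancel₀ X_ne_zero (h.trans (mul_one X).symm)

open PowerSeries in
-- The two recurrences become `hQ` and `hR`; eliminating the tree sums gives `2X / (1 - X)²` times
-- the series of `euclidSum`. The factor `2/3` arises from writing `2X` as `(2/3) 3X`, to match `3X
-- / (1 - 3X)²`.
theorem mk_countEntropy : PowerSeries.mk countEntropy =
    C (2 / 3 : ℝ) * (PowerSeries.mk (fun n => (n : ℝ) * 3 ^ n) * PowerSeries.mk ellConv) := by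
  have hQ : (1 - X) * PowerSeries.mk treeEntropy = PowerSeries.mk euclidSum := by
    ext n
    rcases n with _ | n
    · simp [treeEntropy_zero, euclidSum_zero]
    · simp [sub_mul, coeff_succ_X_mul, treeEntropy_succ]
  have hR : (1 - X) * PowerSeries.mk countEntropy = C 2 * (X * PowerSeries.mk treeEntropy) := by
    ext n
    rcases n with _ | n
    · simp [countEntropy_zero]
    · rw [coeff_C_mul]
      simp [sub_mul, coeff_succ_X_mul, countEntropy_succ]
  have hc : PowerSeries.mk ellConv = PowerSeries.mk (fun n => (n : ℝ) + 1) * PowerSeries.mk ell := by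
    ext n
    simp [coeff_mul, ellConv]
  have hl : PowerSeries.mk ell = (1 - C (3 : ℝ) * X) ^ 2 * PowerSeries.mk euclidSum := by
    ext n
    simp [ell]
  have h3 := one_sub_C_mul_X_sq_mul_mk 3
  have h1 := one_sub_X_sq_mul_mk
  have hne : (1 - X : PowerSeries ℝ) ^ 2 ≠ 0 := by
    intro h
    rw [h, zero_mul] at h1
    exact zero_ne_one h1
  have hC : (C (2 / 3) * C 3 : PowerSeries ℝ) = C 2 := by
    rw [← map_mul]
    norm_num
  refine mul_left_cancel₀ hne ?_
  rw [hc, hl]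
  generalize PowerSeries.mk (fun n => (n : ℝ) * 3 ^ n) = B at *
  generalize PowerSeries.mk (fun n => (n : ℝ) + 1) = A at *
  linear_combination (1 - X) * hR + C 2 * X * hQ - C (2 / 3) * PowerSeries.mk euclidSum * B * (1 - C 3 * X) ^ 2 * h1 - C (2 / 3) * PowerSeries.mk euclidSum * h3 - PowerSeries.mk euclidSum * X * hC

/-- Division by `3 ^ n` turns `3x / (1 - 3x)²` into `x / (1 - x)²`, whose coefficients are `n`. -/
theorem levelEntropy_eq_sum (n : ℕ) : levelEntropy 3 2 (uniformProb 3) n =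
    ∑ p ∈ antidiagonal n, (p.1 : ℝ) * coeffT p.2 := by
  have h : countEntropy n =
      2 / 3 * ∑ p ∈ antidiagonal n, ((p.1 : ℝ) * 3 ^ p.1) * ellConv p.2 := by
    have := congrArg (PowerSeries.coeff n) mk_countEntropy
    rw [PowerSeries.coeff_C_mul] at this
    simpa [PowerSeries.coeff_mul] using this
  have h0 : ∑ p ∈ antidiagonal n, (p.1 : ℝ) * (if p.2 = 0 then Real.logb 2 3 else 0) =
      n * Real.logb 2 3 := by
    rw [sum_eq_single (n, 0)]
    · simp
    · rintro ⟨i, j⟩ hp hne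
      rw [HasAntidiagonal.mem_antidiagonal] at hp
      rw [if_neg, mul_zero]
      rintro rfl
      exact hne (by simp_all)
    · simp
  simp only [coeffT, mul_sub, sum_sub_distrib]
  rw [levelEntropy_eq, h0, h, mul_sum, sum_div]
  congr 1
  refine sum_congr rfl fun p hp => ?_
  rw [← HasAntidiagonal.mem_antidiagonal.1 hp, pow_add]
  field_simp

/-! ### Analysis of the generating functions -/

theorem summable_ell_mul_pow {x : ℂ} (hx : ‖x‖ < 1) : Summable fun n => (ell n : ℂ) * x ^ n := by
  refine Summable.of_norm_bounded summable_abs_ell fun n => ?_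
  rw [norm_mul, norm_pow, Complex.norm_real, Real.norm_eq_abs]
  exact mul_le_of_le_one_right (abs_nonneg _) (pow_le_one₀ (norm_nonneg _) hx.le)

theorem differentiableOn_L : DifferentiableOn ℂ L (Metric.ball 0 1) := by
  refine Complex.differentiableOn_tsum_of_summable_norm summable_abs_ell
    (fun n => by fun_prop) Metric.isOpen_ball fun n x hx => ?_
  rw [norm_mul, norm_pow, Complex.norm_real, Real.norm_eq_abs]
  exact mul_le_of_le_one_right (abs_nonneg _)
    (pow_le_one₀ (norm_nonneg _) (mem_ball_zero_iff.1 hx).le)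

theorem norm_div_three_lt_one {x : ℂ} (hx : ‖x‖ < 3) : ‖x / 3‖ < 1 := by
  rw [norm_div, Complex.norm_ofNat]
  linarith

theorem one_sub_ne_zero_of_norm_lt_one {x : ℂ} (hx : ‖x‖ < 1) : 1 - x ≠ 0 := by
  intro h
  rw [← sub_eq_zero.1 h, norm_one] at hx
  exact lt_irrefl _ hx

theorem analyticOnNhd_T32 : AnalyticOnNhd ℂ T32 (Metric.ball 0 3) := by
  refine DifferentiableOn.analyticOnNhd ?_ Metric.isOpen_ball
  have hL : DifferentiableOn ℂ (fun x : ℂ => L (x / 3)) (Metric.ball 0 3) :=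
    differentiableOn_L.comp (by fun_prop) fun x hx =>
      mem_ball_zero_iff.2 (norm_div_three_lt_one (mem_ball_zero_iff.1 hx))
  refine (differentiableOn_const _).sub (DifferentiableOn.mul ?_ hL)
  refine (differentiableOn_const _).div (by fun_prop) fun x hx => ?_
  have := one_sub_ne_zero_of_norm_lt_one (norm_div_three_lt_one (mem_ball_zero_iff.1 hx))
  exact mul_ne_zero three_ne_zero (pow_ne_zero 2 this)

theorem hasSum_succ_mul_geometric {x : ℂ} (hx : ‖x‖ < 1) :
    HasSum (fun n : ℕ => ((n : ℂ) + 1) * x ^ n) (1 / (1 - x) ^ 2) := by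
  have h := (hasSum_coe_mul_geometric_of_norm_lt_one hx).add (hasSum_geometric_of_norm_lt_one hx)
  have hne := one_sub_ne_zero_of_norm_lt_one hx
  have e : x / (1 - x) ^ 2 + (1 - x)⁻¹ = 1 / (1 - x) ^ 2 := by
    field_simp
    ring
  rw [e] at h
  simpa only [add_mul, one_mul] using h

theorem hasSum_antidiagonal_mul {f g : ℕ → ℂ} {x a b : ℂ} (hf : HasSum (fun n => f n * x ^ n) a)
    (hg : HasSum (fun n => g n * x ^ n) b) :
    HasSum (fun n => (∑ p ∈ antidiagonal n, f p.1 * g p.2) * x ^ n) (a * b) := by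
  have e : (fun n => (∑ p ∈ antidiagonal n, f p.1 * g p.2) * x ^ n) =
      fun n => ∑ p ∈ antidiagonal n, (f p.1 * x ^ p.1) * (g p.2 * x ^ p.2) := by
    ext n
    rw [sum_mul]
    refine sum_congr rfl fun p hp => ?_
    rw [← HasAntidiagonal.mem_antidiagonal.1 hp, pow_add]
    ring
  rw [e, ← hf.tsum_eq, ← hg.tsum_eq,
    tsum_mul_tsum_eq_tsum_sum_antidiagonal_of_summable_norm hf.summable.norm hg.summable.norm]
  exact (summable_norm_sum_mul_antidiagonal_of_summable_norm
    hf.summable.norm hg.summable.norm).of_norm.hasSum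

theorem hasSum_coeffT {x : ℂ} (hx : ‖x‖ < 3) :
    HasSum (fun n => (coeffT n : ℂ) * x ^ n) (T32 x) := by
  have hx' := norm_div_three_lt_one hx
  have h1 := hasSum_antidiagonal_mul (hasSum_succ_mul_geometric hx')
    (summable_ell_mul_pow hx').hasSum
  have h2 : HasSum (fun n : ℕ => if n = 0 then (Real.logb 2 3 : ℂ) else 0)
      (Real.logb 2 3 : ℂ) := hasSum_ite_eq 0 _
  have hne := one_sub_ne_zero_of_norm_lt_one hx'
  have e : T32 x = (Real.logb 2 3 : ℂ) -
      2 / 3 * (1 / (1 - x / 3) ^ 2 * ∑' n, (ell n : ℂ) * (x / 3) ^ n) := by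
    simp only [T32, L]
    field_simp
  rw [e]
  refine (h2.sub (h1.mul_left (2 / 3))).congr_fun fun n => ?_
  simp only [coeffT, ellConv]
  push_cast
  rw [sub_mul, div_pow]
  congr 1
  · rcases n with _ | n <;> simp
  · ring

theorem hasSum_levelEntropy {x : ℂ} (hx : ‖x‖ < 1) :
    HasSum (fun n : ℕ => (levelEntropy 3 2 (uniformProb 3) n : ℂ) * x ^ n)
      (x / (x - 1) ^ 2 * T32 x) := by
  have h := hasSum_antidiagonal_mul (hasSum_coe_mul_geometric_of_norm_lt_one hx)
    (hasSum_coeffT (x := x) (by linarith))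
  rw [← neg_sub 1 x, neg_sq]
  convert h using 3 with n
  rw [levelEntropy_eq_sum]
  push_cast
  rfl

/-- Any radius strictly between 1 and 3 would do: it dominates the series on a neighbourhood of 1,
allowing termwise differentiation there. -/
theorem summable_abs_coeffT_mul_two_pow : Summable fun n => |coeffT n| * 2 ^ n := by
  have h := (hasSum_coeffT (x := 2) (by norm_num)).summable.norm
  simpa using h

theorem hasSum_deriv_T32 : HasSum (fun n => (coeffT n : ℂ) * n) (deriv T32 1) := by
  have h := Complex.hasSum_deriv_of_summable_norm (F := fun n x => (coeffT n : ℂ) * x ^ n)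
    (U := Metric.ball 0 2) (z := 1) summable_abs_coeffT_mul_two_pow (fun n => by fun_prop)
    Metric.isOpen_ball (fun n x hx => ?_) (by simp)
  · have e : (fun x : ℂ => ∑' n, (coeffT n : ℂ) * x ^ n) =ᶠ[nhds 1] T32 := by
      filter_upwards [Metric.isOpen_ball.mem_nhds
        (show (1 : ℂ) ∈ Metric.ball 0 3 by simp)] with x hx
      exact (hasSum_coeffT (mem_ball_zero_iff.1 hx)).tsum_eq
    rw [e.deriv_eq] at h
    simpa using h
  · rw [norm_mul, norm_pow, Complex.norm_real, Real.norm_eq_abs]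
    exact mul_le_mul_of_nonneg_left
      (pow_le_pow_left₀ (norm_nonneg _) (mem_ball_zero_iff.1 hx).le _) (abs_nonneg _)

/-- If `∑ t n` and `∑ n t n` converge, the convolution of `t` with the identity is asymptotically affine. -/
theorem tendsto_antidiagonal_sub {t : ℕ → ℂ} {a b : ℂ} (ha : HasSum t a)
    (hb : HasSum (fun n => t n * n) b) :
    Filter.Tendsto (fun n : ℕ => ∑ p ∈ antidiagonal n, (p.1 : ℂ) * t p.2 - (a * n - b))
      Filter.atTop (nhds 0) := by
  -- The error is the tail of `∑ k t(k)` minus `n` times the tail of `∑ t(k)`.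
  have e (n : ℕ) : ∑ p ∈ antidiagonal n, (p.1 : ℂ) * t p.2 - (a * n - b) =
      (b - ∑ k ∈ range (n + 1), t k * k) - n * (a - ∑ k ∈ range (n + 1), t k) := by
    have h : ∑ p ∈ antidiagonal n, (p.1 : ℂ) * t p.2 =
        n * ∑ k ∈ range (n + 1), t k - ∑ k ∈ range (n + 1), t k * k := by
      rw [← Finset.Nat.sum_antidiagonal_swap]
      simp only [Prod.fst_swap, Prod.snd_swap]
      rw [Finset.Nat.sum_antidiagonal_eq_sum_range_succ (fun i j => (j : ℂ) * t i), mul_sum,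
        ← sum_sub_distrib]
      refine sum_congr rfl fun k hk => ?_
      rw [Nat.cast_sub (by simpa [Nat.lt_succ_iff] using hk)]
      ring
    rw [h]
    ring
  simp only [e]
  have h1 : Filter.Tendsto (fun n : ℕ => b - ∑ k ∈ range (n + 1), t k * k) Filter.atTop
      (nhds 0) := by
    simpa using (hb.tendsto_sum_nat.comp (Filter.tendsto_add_atTop_nat 1)).const_sub b
  have h2 : Filter.Tendsto (fun n : ℕ => (n : ℂ) * (a - ∑ k ∈ range (n + 1), t k)) Filter.atTop
      (nhds 0) := by
    have hn := hb.summable.norm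
    refine squeeze_zero_norm (fun n => ?_)
      ((tendsto_sum_nat_add fun n => ‖t n * n‖).comp (Filter.tendsto_add_atTop_nat 1))
    have h3 : a - ∑ k ∈ range (n + 1), t k = ∑' k, t (k + (n + 1)) := by
      rw [← ha.tsum_eq, ← ha.summable.sum_add_tsum_nat_add (n + 1)]
      ring
    have hs := (summable_nat_add_iff (n + 1)).2 hn
    rw [h3, ← tsum_mul_left]
    refine tsum_of_norm_bounded hs.hasSum fun k => ?_
    rw [norm_mul, norm_mul, mul_comm, Complex.norm_natCast, Complex.norm_natCast]
    -- Indices in the tail exceed `n`, so the factor `n` is absorbed into the tail of `∑ ‖k t(k)‖`.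
    refine mul_le_mul_of_nonneg_left ?_ (norm_nonneg _)
    exact_mod_cast (by omega : n ≤ k + (n + 1))
  simpa using h1.sub h2

theorem tendsto_levelEntropy_sub : Filter.Tendsto
    (fun n : ℕ => (levelEntropy 3 2 (uniformProb 3) n : ℂ) - (T32 1 * (n : ℂ) - deriv T32 1))
    Filter.atTop (nhds 0) := by
  have h := hasSum_coeffT (x := 1) (by norm_num)
  simp only [one_pow, mul_one] at h
  convert tendsto_antidiagonal_sub h hasSum_deriv_T32 using 3 with n
  rw [levelEntropy_eq_sum]
  push_cast
  rfl

theorem exists_hasGarsiaEntropy :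
    ∃ H : ℝ, HasGarsiaEntropy 3 2 (uniformProb 3) H ∧ (H : ℂ) = T32 1 := by
  have hT := hasSum_coeffT (x := 1) (by norm_num)
  simp only [one_pow, mul_one] at hT
  -- The coefficients are real, so `T(1)` is real.
  have hH : ((∑' n, coeffT n : ℝ) : ℂ) = T32 1 := by rw [Complex.ofReal_tsum, hT.tsum_eq]
  refine ⟨_, ?_, hH⟩
  have h0 : Filter.Tendsto (fun n : ℕ => ((n : ℂ))⁻¹) Filter.atTop (nhds 0) :=
    tendsto_inv_atTop_nhds_zero_nat
  have h1 := ((tendsto_levelEntropy_sub.mul h0).sub (h0.const_mul (deriv T32 1))).add_const (T32 1)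
  simp only [mul_zero, sub_zero, zero_add] at h1
  have h2 := (Complex.continuous_re.tendsto _).comp h1
  rw [← hH, Complex.ofReal_re] at h2
  refine h2.congr' ?_
  filter_upwards [Filter.eventually_gt_atTop 0] with n hn
  have hn' : (n : ℂ) ≠ 0 := by exact_mod_cast hn.ne'
  have e : ((levelEntropy 3 2 (uniformProb 3) n : ℂ) - (T32 1 * (n : ℂ) - deriv T32 1)) *
      (n : ℂ)⁻¹ - deriv T32 1 * (n : ℂ)⁻¹ + T32 1 =
      ((levelEntropy 3 2 (uniformProb 3) n / n : ℝ) : ℂ) := by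
    push_cast
    field_simp
    ring
  simp only [Function.comp_apply]
  rw [hH, e, Complex.ofReal_re]
  simp [Real.logb_self_eq_one]

end CantorLike

theorem corollary3p2 :
    -- every power series involved converges where it is used
    (∀ x : ℂ, ‖x‖ < 1 → Summable fun n : ℕ => (CantorLike.ell n : ℂ) * x ^ n) ∧
    -- `T = T_{3,2}` is analytic on `|x| < 3`, and `H(x) = x / (x - 1)² * T(x)`
    AnalyticOnNhd ℂ CantorLike.T32 (Metric.ball 0 3) ∧
    (∀ x : ℂ, ‖x‖ < 1 →
      HasSum
        (fun n : ℕ =>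
          (CantorLike.levelEntropy 3 2 (CantorLike.uniformProb 3) n : ℂ) * x ^ n)
        (x / (x - 1) ^ 2 * CantorLike.T32 x)) ∧
    -- the Garsia entropy of the uniform (3,2)-measure exists and equals `T(1)`
    (∃ H : ℝ, CantorLike.HasGarsiaEntropy 3 2 (CantorLike.uniformProb 3) H ∧
      (H : ℂ) = CantorLike.T32 1) ∧
    -- `h(n) = T(1) n - T'(1) + o(1)`
    Filter.Tendsto
      (fun n : ℕ =>
        (CantorLike.levelEntropy 3 2 (CantorLike.uniformProb 3) n : ℂ) -
          (CantorLike.T32 1 * (n : ℂ) - deriv CantorLike.T32 1))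
      Filter.atTop (nhds 0) := by
  exact ⟨fun _ => CantorLike.summable_ell_mul_pow, CantorLike.analyticOnNhd_T32,
    fun _ => CantorLike.hasSum_levelEntropy, CantorLike.exists_hasGarsiaEntropy,
    CantorLike.tendsto_levelEntropy_sub⟩
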